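/- Let $m,N\ge 1$ be integers, let $\theta>0$, and let $x_{n,k},y_{n,k}$ ($1\le n\le N$, $1\le k\le m$) be independent $\mathcal N(0,1/2)$ random variables. For real $\rho_2,\dots,\rho_N$ with $|\rho_n|<1$ put $$g_{1,k}=x_{1,k}+\jmath y_{1,k},\qquad g_{n,k}=\sqrt{1-\rho_n^2}\,x_{n,k}+\rho_n x_{1,k}+\jmath\left(\sqrt{1-\rho_n^2}\,y_{n,k}+\rho_n y_{1,k}\right)\quad(n\ge 2),$$ and $\hat h_n=\sum_{k=1}^m|g_{n,k}|^2$. For $\bar\eta\in\mathbb R$ let $\hat\eta_n=\frac{\bar\eta}{m}\hat h_n$ be the estimated SNR at port $n$, let $\hat\eta=\max_{1\le n\le N}\hat\eta_n$, and let $P_{\rm o}(\theta)=\mathbb P\{\log_2(1+\hat\eta)<\theta\}$ be the outage probability. Then: (i) $\mathbb E[\hat\eta_n]=\bar\eta$ for every $n$, and, as $\bar\eta\to\infty$, $$P_{\rm o}(\theta)\sim\left(\frac{m}{\bar\eta}(2^\theta-1)\right)^{mN}\frac{\Gamma(m+1)^{-N}}{\prod_{n=2}^N(1-\rho_n^2)^m},$$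 that is, the ratio of the two sides tends to $1$. Consequently the diversity order is $\lim_{\bar\eta\to\infty}-\log P_{\rm o}(\theta)/\log\bar\eta=mN$, whatever the $\rho_n$, and the correlation enters only the outage gain $$G_o=\lim_{\bar\eta\to\infty}\bar\eta^{\,mN}P_{\rm o}(\theta)=\frac{(m(2^\theta-1))^{mN}}{\Gamma(m+1)^N\prod_{n=2}^N(1-\rho_n^2)^m}>0.$$ (ii) For every topology, that is, for every wavelength $\lambda>0$ and all displacements $d_2,\dots,d_N>0$ of the ports from the first one, the coefficients $\rho_n=J_0(2\pi d_n/\lambda)$ ($J_0$ the Bessel function of the first kind of order $0$) satisfy $|\rho_n|<1$ for $n\ge2$, so the diversity order is $mN$ and the outage gain is $G_o$. (iii) In particular, for every $W>0$ this holds for the linear topology $d_n=\frac{n-1}{N-1}W\lambda$, the circular topology $d_n=\sin\left(\frac{n-1}{N}\pi\right)W\lambda$ and the wheel-shaped topology $d_n=\frac{W\lambda}{2}$ ($n\ge2$), for all of which $d_n>0$ for $n\ge 2$. -/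

import Mathlib

open MeasureTheory ProbabilityTheory Filter Topology Asymptotics
open scoped NNReal

noncomputable section

namespace FluidAntenna

/-- The Bessel function of the first kind of order zero, by Bessel's integral
`J₀(z) = (1/π) ∫₀^π cos (z sin t) dt`. -/
def besselJ0 (z : ℝ) : ℝ :=
  (1 / Real.pi) * ∫ t in (0 : ℝ)..Real.pi, Real.cos (z * Real.sin t)

/-- The three antenna architectures. -/
inductive Architecture : Type
  | linear
  | circular
  | wheel

/-- Distance of a port from the first port, for an antenna of size `W * lam`. Ports are numbered
from `0`, so the index `n` here is the `(n + 1)`-st port. -/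
def displacement {N : ℕ} (a : Architecture) (W lam : ℝ) (n : Fin N) : ℝ :=
  match a with
  | Architecture.linear => ((n : ℕ) : ℝ) / ((N : ℝ) - 1) * (W * lam)
  | Architecture.circular => Real.sin (((n : ℕ) : ℝ) / (N : ℝ) * Real.pi) * (W * lam)
  | Architecture.wheel => if 0 < (n : ℕ) then W * lam / 2 else 0

/-- Correlation coefficients `J₀(2π dₙ / lam)` for displacements `dₙ` and wavelength `lam`. -/
def spatialCorrelation {N : ℕ} (d : Fin N → ℝ) (lam : ℝ) (n : Fin N) : ℝ :=
  besselJ0 (2 * Real.pi * (d n / lam))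

variable {Ω : Type*} {N m : ℕ} [NeZero N]

/-- The complex Gaussian variables `g n k` (with `σ = 1`); port `0` is the reference port. -/
def gain (ρ : Fin N → ℝ) (x y : Fin N → Fin m → Ω → ℝ) (n : Fin N) (k : Fin m) (ω : Ω) : ℂ :=
  if n = 0 then (x 0 k ω : ℂ) + Complex.I * (y 0 k ω : ℂ)
  else ((Real.sqrt (1 - ρ n ^ 2) * x n k ω + ρ n * x 0 k ω : ℝ) : ℂ)
    + Complex.I * ((Real.sqrt (1 - ρ n ^ 2) * y n k ω + ρ n * y 0 k ω : ℝ) : ℂ)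

/-- The channel power `∑ₖ |g n k|²` at port `n`, the square of a Nakagami-`m` envelope. -/
def channel (ρ : Fin N → ℝ) (x y : Fin N → Fin m → Ω → ℝ) (n : Fin N) (ω : Ω) : ℝ :=
  ∑ k, ‖gain ρ x y n k ω‖ ^ 2

/-- The signal-to-noise ratio at port `n`; `s` is transmit power over noise variance. -/
def portSNR (ρ : Fin N → ℝ) (x y : Fin N → Fin m → Ω → ℝ) (s : ℝ) (n : Fin N) (ω : Ω) : ℝ :=
  s / (m : ℝ) * channel ρ x y n ω

/-- The signal-to-noise ratio of the strongest port. -/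
def selectedSNR (ρ : Fin N → ℝ) (x y : Fin N → Fin m → Ω → ℝ) (s : ℝ) (ω : Ω) : ℝ :=
  Finset.univ.sup' Finset.univ_nonempty (fun n => portSNR ρ x y s n ω)

/-- The probability that `log₂ (1 + SNR)` of the strongest port is below the rate threshold. -/
def outageProbability [MeasurableSpace Ω] (μ : Measure Ω) (ρ : Fin N → ℝ)
    (x y : Fin N → Fin m → Ω → ℝ) (θ s : ℝ) : ℝ :=
  μ.real {ω | Real.logb 2 (1 + selectedSNR ρ x y s ω) < θ}

/-- The outage gain `(m (2^θ - 1))^(mN) / (Γ(m+1)^N ∏_{n ≠ 0} (1 - ρₙ²)^m)`. -/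
def outageGain (m : ℕ) (ρ : Fin N → ℝ) (θ : ℝ) : ℝ :=
  ((m : ℝ) * ((2 : ℝ) ^ θ - 1)) ^ (m * N)
    / (Real.Gamma ((m : ℝ) + 1) ^ N * ∏ n ∈ Finset.univ.erase (0 : Fin N), (1 - ρ n ^ 2) ^ m)

/-- An outage probability, as a function of the average SNR `s`, has diversity order `d` if
`- log (Pout s) / log s → d` as `s → ∞`. -/
def HasDiversityOrder (Pout : ℝ → ℝ) (d : ℝ) : Prop :=
  Tendsto (fun s => - Real.log (Pout s) / Real.log s) atTop (𝓝 d)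

/-- `G` is the outage gain at diversity order `d`: `Pout s` behaves like `G * s ^ (-d)`. -/
def HasOutageGain (Pout : ℝ → ℝ) (d : ℕ) (G : ℝ) : Prop :=
  Tendsto (fun s => Pout s * s ^ d) atTop (𝓝 G)

end FluidAntenna

end

open FluidAntenna

/-! Put `t = m (2 ^ θ - 1) / s`. Outage means that every correlated row, read as a vector of `2m`
reals, lies in the open ball of squared radius `t`. As `s → ∞` this region shrinks to the origin,
where the density of the independent Gaussians is nearly its peak `π ^ (-mN)`, so the outage
probability is asymptotic to `π ^ (-mN)` times a volume (`tendsto_gaussianArray_outageRegion`).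

The volume is exact (`volume_outageRegion`). For a fixed reference row, each other row ranges over a
ball that is translated by a multiple of the reference row and dilated by `1 / √(1 - ρₙ²)`. The
translation does not affect volume, so correlation contributes only the factors `(1 - ρₙ²) ^ (-m)`,
while the `N` balls of volume `(π t) ^ m / Γ(m + 1)` give the power `t ^ (mN)`.

The diversity order and the equivalence follow from this limit because it is positive. The Bessel
coefficients qualify since `J₀(z)` is an average of cosines not all of modulus `1` when `z > 0`
(`abs_besselJ0_lt_one`). -/

namespace FluidAntenna

open scoped ENNReal

/-! ### Comparison of product measures -/

section PiComparison

variable {ι : Type*} [Fintype ι] {α : ι → Type*} [∀ i, MeasurableSpace (α i)]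

/-- The product comes from the largest outer measure dominated by products on boxes, so comparing
boxes suffices and no σ-finiteness is needed. -/
lemma measure_pi_mono {μ ν : ∀ i, Measure (α i)} (h : ∀ i, μ i ≤ ν i) :
    Measure.pi μ ≤ Measure.pi ν := by
  refine Measure.le_iff.2 fun s hs ↦ ?_
  rw [Measure.pi_def, Measure.pi_def, toMeasure_apply _ _ hs, toMeasure_apply _ _ hs]
  refine (OuterMeasure.le_pi.2 fun t _ ↦ ?_) s
  exact (OuterMeasure.pi_pi_le _ _).trans (Finset.prod_le_prod' fun i _ ↦ h i (t i))

lemma measure_pi_const_smul {ν : ∀ i, Measure (α i)} [∀ i, SigmaFinite (ν i)] {c : ℝ≥0∞}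
    (hc : c ≠ ∞) : Measure.pi (fun i ↦ c • ν i) = c ^ Fintype.card ι • Measure.pi ν := by
  lift c to ℝ≥0 using hc
  have : ∀ i, SigmaFinite ((c : ℝ≥0∞) • ν i) := fun i ↦ SMul.sigmaFinite c
  refine Measure.pi_eq fun s _ ↦ ?_
  simp [Measure.pi_pi, Finset.prod_mul_distrib]

lemma measure_pi_le_smul {μ ν : ∀ i, Measure (α i)} [∀ i, SigmaFinite (ν i)] {c : ℝ≥0∞}
    (hc : c ≠ ∞) (h : ∀ i, μ i ≤ c • ν i) :
    Measure.pi μ ≤ c ^ Fintype.card ι • Measure.pi ν :=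
  (measure_pi_mono h).trans_eq (measure_pi_const_smul hc)

lemma smul_restrict_le_measure_pi {μ ν : ∀ i, Measure (α i)} [∀ i, SigmaFinite (ν i)] {c : ℝ≥0∞}
    (hc : c ≠ ∞) {s : ∀ i, Set (α i)} (h : ∀ i, c • (ν i).restrict (s i) ≤ μ i) :
    c ^ Fintype.card ι • (Measure.pi ν).restrict (Set.univ.pi s) ≤ Measure.pi μ := by
  rw [Measure.restrict_pi_pi, ← measure_pi_const_smul hc]
  exact measure_pi_mono h

end PiComparison

/-! ### The Gaussian law of variance one half -/

lemma gaussianPDFReal_zero_half (x : ℝ) :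
    gaussianPDFReal 0 (1 / 2) x = (√Real.pi)⁻¹ * Real.exp (-x ^ 2) := by
  have h : (((1 / 2 : ℝ≥0)) : ℝ) = 1 / 2 := by norm_num
  rw [gaussianPDFReal, h]
  congr 2 <;> ring_nf

lemma gaussianReal_zero_half_le :
    gaussianReal 0 (1 / 2) ≤ ENNReal.ofReal (√Real.pi)⁻¹ • (volume : Measure ℝ) := by
  rw [gaussianReal_of_var_ne_zero _ (by norm_num), ← withDensity_const]
  refine withDensity_mono (ae_of_all _ fun x ↦ ENNReal.ofReal_le_ofReal ?_)
  rw [gaussianPDFReal_zero_half]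
  exact mul_le_of_le_one_right (by positivity) (Real.exp_le_one_iff.2 (by nlinarith))

lemma smul_restrict_le_gaussianReal_zero_half (R : ℝ) :
    ENNReal.ofReal ((√Real.pi)⁻¹ * Real.exp (-R)) •
      (volume : Measure ℝ).restrict {x | x ^ 2 ≤ R} ≤ gaussianReal 0 (1 / 2) := by
  have hs : MeasurableSet {x : ℝ | x ^ 2 ≤ R} := measurableSet_le (by fun_prop) (by fun_prop)
  rw [gaussianReal_of_var_ne_zero _ (by norm_num), ← withDensity_const]
  refine (withDensity_mono ?_).trans
    ((restrict_withDensity hs _).symm.le.trans Measure.restrict_le_self)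
  filter_upwards [ae_restrict_mem hs] with x hx
  refine ENNReal.ofReal_le_ofReal ?_
  rw [gaussianPDFReal_zero_half]
  have : x ^ 2 ≤ R := hx
  gcongr

/-- The law of independent centred Gaussian variables of variance `1 / 2`, indexed by `ι` and
`κ`. -/
noncomputable def gaussianArray (ι κ : Type*) [Fintype ι] [Fintype κ] : Measure (ι → κ → ℝ) :=
  Measure.pi fun _ ↦ Measure.pi fun _ ↦ gaussianReal 0 (1 / 2)

section GaussianArray

variable {ι κ : Type*} [Fintype ι] [Fintype κ]

instance : IsProbabilityMeasure (gaussianArray ι κ) := by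
  unfold gaussianArray; infer_instance

lemma gaussianArray_le :
    gaussianArray ι κ ≤ (ENNReal.ofReal (√Real.pi)⁻¹ ^ Fintype.card κ) ^ Fintype.card ι • volume :=
  measure_pi_le_smul (by finiteness) fun _ ↦
    measure_pi_le_smul (by finiteness) fun _ ↦ gaussianReal_zero_half_le

lemma smul_restrict_le_gaussianArray (R : ℝ) :
    (ENNReal.ofReal ((√Real.pi)⁻¹ * Real.exp (-R)) ^ Fintype.card κ) ^ Fintype.card ι •
      (volume : Measure (ι → κ → ℝ)).restrict {z | ∀ i j, z i j ^ 2 ≤ R} ≤ gaussianArray ι κ := by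
  have h := smul_restrict_le_measure_pi (ι := ι)
    (ν := fun _ ↦ (Measure.pi fun _ : κ ↦ (volume : Measure ℝ))) (by finiteness) fun _ ↦
    smul_restrict_le_measure_pi (ι := κ) (by finiteness) fun _ ↦
      smul_restrict_le_gaussianReal_zero_half R
  have hset : {z : ι → κ → ℝ | ∀ i j, z i j ^ 2 ≤ R}
      = Set.univ.pi fun _ ↦ Set.univ.pi fun _ ↦ {x : ℝ | x ^ 2 ≤ R} := by
    ext z
    simp
  rw [hset]
  exact h

lemma gaussianArray_real_le {s : Set (ι → κ → ℝ)} (hv : volume s ≠ ∞) :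
    (gaussianArray ι κ).real s
      ≤ ((√Real.pi)⁻¹ ^ Fintype.card κ) ^ Fintype.card ι * volume.real s := by
  have h := gaussianArray_le (ι := ι) (κ := κ) s
  have := ENNReal.toReal_mono (by rw [Measure.smul_apply, smul_eq_mul]; finiteness) h
  simpa [Measure.real, ENNReal.toReal_ofReal (inv_nonneg.2 (Real.sqrt_nonneg Real.pi))] using this

lemma le_gaussianArray_real {s : Set (ι → κ → ℝ)} {R : ℝ} (hR : ∀ z ∈ s, ∀ i j, z i j ^ 2 ≤ R) :
    (((√Real.pi)⁻¹ * Real.exp (-R)) ^ Fintype.card κ) ^ Fintype.card ι * volume.real s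
      ≤ (gaussianArray ι κ).real s := by
  have h := smul_restrict_le_gaussianArray (ι := ι) (κ := κ) R s
  rw [Measure.smul_apply, Measure.restrict_eq_self _
    (show s ⊆ {z : ι → κ → ℝ | ∀ i j, z i j ^ 2 ≤ R} from hR)] at h
  have := ENNReal.toReal_mono (by finiteness) h
  have h0 : 0 ≤ (√Real.pi)⁻¹ * Real.exp (-R) := by positivity
  simpa only [Measure.real, smul_eq_mul, ENNReal.toReal_mul, ENNReal.toReal_pow,
    ENNReal.toReal_ofReal h0] using this

end GaussianArray

/-! ### The Bessel function -/

lemma abs_besselJ0_lt_one {z : ℝ} (hz : 0 < z) : |besselJ0 z| < 1 := by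
  have hpi := Real.pi_pos
  have hcont : Continuous fun t ↦ Real.cos (z * Real.sin t) := by fun_prop
  have key : |∫ t in (0 : ℝ)..Real.pi, Real.cos (z * Real.sin t)| < Real.pi := by
    calc |∫ t in (0 : ℝ)..Real.pi, Real.cos (z * Real.sin t)|
        ≤ ∫ t in (0 : ℝ)..Real.pi, |Real.cos (z * Real.sin t)| :=
          intervalIntegral.abs_integral_le_integral_abs hpi.le
      _ < ∫ _t in (0 : ℝ)..Real.pi, (1 : ℝ) := by
          refine intervalIntegral.integral_lt_integral_of_continuousOn_of_le_of_exists_lt hpi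
            hcont.abs.continuousOn continuousOn_const (fun t _ ↦ Real.abs_cos_le_one _) ?_
          -- One point with `|cos| < 1` gives strictness. At `t = arcsin a` the argument `z * sin t
          -- = z * a` lies in `(0, 1]`, where the cosine is strictly between `0` and `1`.
          set a : ℝ := min (1 / z) 1 with ha
          have ha0 : 0 < a := by positivity
          have ha1 : a ≤ 1 := min_le_right _ _
          refine ⟨Real.arcsin a, ⟨Real.arcsin_nonneg.2 ha0.le,
            (Real.arcsin_le_pi_div_two a).trans (by linarith)⟩, ?_⟩
          rw [Real.sin_arcsin (by linarith) ha1]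
          have hza : z * a ≤ 1 := by
            calc z * a ≤ z * (1 / z) := by gcongr; exact min_le_left _ _
              _ = 1 := by field_simp
          have hza0 : 0 < z * a := by positivity
          have hpi3 := Real.pi_gt_three
          rw [abs_of_pos (Real.cos_pos_of_mem_Ioo ⟨by linarith, by linarith⟩), ← Real.cos_zero]
          exact Real.cos_lt_cos_of_nonneg_of_le_pi le_rfl (by linarith) hza0
      _ = Real.pi := by simp
  rw [besselJ0, abs_mul, abs_of_pos (by positivity), one_div, inv_mul_lt_iff₀ hpi, mul_one]
  exact key

lemma displacement_pos {N : ℕ} [NeZero N] (a : Architecture) {W lam : ℝ} (hW : 0 < W)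
    (hlam : 0 < lam) {n : Fin N} (hn : n ≠ 0) : 0 < displacement a W lam n := by
  have hn0 : 0 < (n : ℕ) := Nat.pos_of_ne_zero fun h ↦ hn (Fin.ext (by simpa using h))
  have hn1 : (0 : ℝ) < ((n : ℕ) : ℝ) := by exact_mod_cast hn0
  have hnN : ((n : ℕ) : ℝ) < N := by exact_mod_cast n.2
  cases a with
  | linear =>
    have : (1 : ℝ) ≤ ((n : ℕ) : ℝ) := by exact_mod_cast hn0
    -- A nonzero index forces `N ≥ 2`.
    have : (0 : ℝ) < (N : ℝ) - 1 := by linarith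
    simp only [displacement]
    positivity
  | circular =>
    have hN : (0 : ℝ) < N := hn1.trans hnN
    have h : 0 < Real.sin (((n : ℕ) : ℝ) / (N : ℝ) * Real.pi) :=
      Real.sin_pos_of_pos_of_lt_pi (by positivity)
        (mul_lt_of_lt_one_left Real.pi_pos ((div_lt_one hN).2 hnN))
    simp only [displacement]
    positivity
  | wheel =>
    simp only [displacement, if_pos hn0]
    positivity

lemma abs_spatialCorrelation_lt_one {N : ℕ} {d : Fin N → ℝ} {lam : ℝ} (hlam : 0 < lam) {n : Fin N}
    (hd : 0 < d n) : |spatialCorrelation d lam n| < 1 :=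
  abs_besselJ0_lt_one (by positivity)

/-! ### Volume of the outage region -/

section Volume

variable {K : Type*} [Fintype K]

lemma volume_sum_sq_lt [Nonempty K] (t : ℝ) :
    volume {v : K → ℝ | ∑ j, v j ^ 2 < t}
      = ENNReal.ofReal (√t ^ Fintype.card K *
          (√Real.pi ^ Fintype.card K / Real.Gamma ((Fintype.card K : ℝ) / 2 + 1))) := by
  have h := volume_sum_rpow_lt K (p := 2) (by norm_num) √t
  have hset : {v : K → ℝ | (∑ j, |v j| ^ (2 : ℝ)) ^ (1 / (2 : ℝ)) < √t}
      = {v : K → ℝ | ∑ j, v j ^ 2 < t} := by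
    ext v
    have h0 : 0 ≤ ∑ j, v j ^ 2 := Finset.sum_nonneg fun j _ ↦ sq_nonneg _
    simp only [Real.rpow_two, sq_abs, ← Real.sqrt_eq_rpow, Set.mem_ofPred_eq]
    exact Real.sqrt_lt_sqrt_iff h0
  -- The `ℓᵖ` ball formula carries `2 Γ(1/p + 1)` per coordinate; here `p = 2`.
  have hG : 2 * Real.Gamma (1 / 2 + 1) = √Real.pi := by
    rw [Real.Gamma_add_one (by norm_num), Real.Gamma_one_half_eq]; ring
  rw [hset, hG] at h
  rw [h, ENNReal.ofReal_mul (by positivity), ENNReal.ofReal_pow (by positivity)]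

lemma volume_sum_affine_sq_lt {c : ℝ} (hc : 0 < c) (a : K → ℝ) (t : ℝ) :
    volume {v : K → ℝ | ∑ j, (c * v j + a j) ^ 2 < t}
      = ENNReal.ofReal ((c ^ Fintype.card K)⁻¹) * volume {v : K → ℝ | ∑ j, v j ^ 2 < t} := by
  have h1 : {v : K → ℝ | ∑ j, (c * v j + a j) ^ 2 < t}
      = (fun v ↦ c • v) ⁻¹' ((fun v ↦ v + a) ⁻¹' {v : K → ℝ | ∑ j, v j ^ 2 < t}) := by
    ext v; simp
  rw [h1, Measure.addHaar_preimage_smul _ hc.ne', measure_preimage_add_right,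
    abs_of_pos (by positivity), Module.finrank_fintype_fun_eq_card]

/-- The correlated array: row `0` is kept, row `n ≠ 0` becomes `√(1 - ρₙ²) zₙ + ρₙ z₀`. -/
noncomputable def correlate {N : ℕ} [NeZero N] (ρ : Fin N → ℝ) (z : Fin N → K → ℝ) (n : Fin N)
    (j : K) : ℝ :=
  if n = 0 then z 0 j else √(1 - ρ n ^ 2) * z n j + ρ n * z 0 j

/-- The arrays all of whose correlated rows have squared Euclidean norm below `t`. -/
def outageRegion (K : Type*) [Fintype K] {N : ℕ} [NeZero N] (ρ : Fin N → ℝ) (t : ℝ) :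
    Set (Fin N → K → ℝ) :=
  {z | ∀ n, ∑ j, correlate ρ z n j ^ 2 < t}

lemma measurableSet_outageRegion {N : ℕ} [NeZero N] (ρ : Fin N → ℝ) (t : ℝ) :
    MeasurableSet (outageRegion K ρ t) := by
  refine MeasurableSet.congr (s := ⋂ n, {z | ∑ j, correlate ρ z n j ^ 2 < t})
    (MeasurableSet.iInter fun n ↦ measurableSet_lt ?_ measurable_const) ?_
  · refine Finset.measurable_fun_sum _ fun j _ ↦ Measurable.pow_const ?_ 2
    by_cases hn : n = 0
    · simp only [correlate, hn, if_true]; fun_prop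
    · simp only [correlate, hn, if_false]; fun_prop
  · ext z; simp [outageRegion]

lemma one_sub_sq_pos {r : ℝ} (h : |r| < 1) : 0 < 1 - r ^ 2 := by
  have := (sq_lt_one_iff_abs_lt_one r).2 h
  linarith

/-- Fubini over the reference row `v`: the slice is empty off the ball, and on it is a product of
shifted, dilated balls whose volume does not depend on `v`. -/
lemma volume_outageRegion_succ {N : ℕ} (ρ : Fin (N + 1) → ℝ) (hρ : ∀ n, n ≠ 0 → |ρ n| < 1)
    (t : ℝ) :
    volume (outageRegion K ρ t)
      = volume {v : K → ℝ | ∑ j, v j ^ 2 < t} ^ (N + 1) *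
        ∏ i : Fin N, ENNReal.ofReal ((√(1 - ρ i.succ ^ 2) ^ Fintype.card K)⁻¹) := by
  set B := {v : K → ℝ | ∑ j, v j ^ 2 < t} with hB
  have hBm : MeasurableSet B := measurableSet_lt (by fun_prop) (by fun_prop)
  have hmp := (volume_preserving_piFinSuccAbove (fun _ : Fin (N + 1) ↦ (K → ℝ)) 0).symm
  rw [← hmp.measure_preimage (measurableSet_outageRegion ρ t).nullMeasurableSet,
    Measure.volume_eq_prod,
    Measure.prod_apply (hmp.measurable (measurableSet_outageRegion ρ t))]
  have hslice : ∀ v : K → ℝ, volume (Prod.mk v ⁻¹' ((MeasurableEquiv.piFinSuccAbove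
      (fun _ : Fin (N + 1) ↦ (K → ℝ)) 0).symm ⁻¹' outageRegion K ρ t))
      = B.indicator (fun _ ↦ volume B ^ N *
          ∏ i : Fin N, ENNReal.ofReal ((√(1 - ρ i.succ ^ 2) ^ Fintype.card K)⁻¹)) v := by
    intro v
    have hmem : ∀ w : Fin N → K → ℝ, w ∈ Prod.mk v ⁻¹' ((MeasurableEquiv.piFinSuccAbove
        (fun _ : Fin (N + 1) ↦ (K → ℝ)) 0).symm ⁻¹' outageRegion K ρ t) ↔
        v ∈ B ∧ w ∈ Set.univ.pi fun i : Fin N ↦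
          {u : K → ℝ | ∑ j, (√(1 - ρ i.succ ^ 2) * u j + ρ i.succ * v j) ^ 2 < t} := by
      intro w
      simp [outageRegion, Fin.forall_fin_succ, correlate, hB, Fin.insertNthEquiv, Fin.succ_ne_zero]
    by_cases hv : v ∈ B
    · rw [Set.indicator_of_mem hv, show Prod.mk v ⁻¹' _ = _ from
        Set.ext fun w ↦ (hmem w).trans (and_iff_right hv), volume_pi_pi]
      rw [Finset.prod_congr rfl fun i _ ↦ volume_sum_affine_sq_lt (Real.sqrt_pos.2
        (one_sub_sq_pos (hρ i.succ (Fin.succ_ne_zero i)))) (fun j ↦ ρ i.succ * v j) t]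
      rw [Finset.prod_mul_distrib, Finset.prod_const, Finset.card_univ, Fintype.card_fin, mul_comm]
    · rw [Set.indicator_of_notMem hv, show Prod.mk v ⁻¹' _ = ∅ from
        Set.eq_empty_iff_forall_notMem.2 fun w hw ↦ hv ((hmem w).1 hw).1, measure_empty]
  simp_rw [hslice]
  rw [lintegral_indicator hBm, setLIntegral_const, pow_succ]
  ring

lemma volume_outageRegion {N : ℕ} [NeZero N] (ρ : Fin N → ℝ) (hρ : ∀ n, n ≠ 0 → |ρ n| < 1)
    (t : ℝ) :
    volume (outageRegion K ρ t)
      = volume {v : K → ℝ | ∑ j, v j ^ 2 < t} ^ N *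
        ∏ n ∈ Finset.univ.erase (0 : Fin N),
          ENNReal.ofReal ((√(1 - ρ n ^ 2) ^ Fintype.card K)⁻¹) := by
  obtain ⟨M, rfl⟩ := Nat.exists_eq_succ_of_ne_zero (NeZero.ne N)
  rw [volume_outageRegion_succ ρ hρ t]
  congr 1
  have h : (Finset.univ.erase (0 : Fin (M + 1))) = Finset.univ.map (Fin.succEmb M) := by
    ext n
    rcases Fin.eq_zero_or_eq_succ n with rfl | ⟨k, rfl⟩ <;> simp [Fin.succ_ne_zero]
  rw [h, Finset.prod_map]
  rfl

lemma volume_real_outageRegion {N m : ℕ} [NeZero N] [NeZero m] (ρ : Fin N → ℝ)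
    (hρ : ∀ n, n ≠ 0 → |ρ n| < 1) {t : ℝ} (ht : 0 ≤ t) :
    volume.real (outageRegion (Fin m ⊕ Fin m) ρ t)
      = t ^ (m * N) * (Real.pi ^ (m * N) / (Real.Gamma ((m : ℝ) + 1) ^ N *
        ∏ n ∈ Finset.univ.erase (0 : Fin N), (1 - ρ n ^ 2) ^ m)) := by
  have hK : Fintype.card (Fin m ⊕ Fin m) = 2 * m := by simp [two_mul]
  have hK' : ((2 * m : ℕ) : ℝ) / 2 + 1 = (m : ℝ) + 1 := by push_cast; ring
  have hΓ : 0 < Real.Gamma ((m : ℝ) + 1) := Real.Gamma_pos_of_pos (by positivity)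
  rw [Measure.real, volume_outageRegion ρ hρ t, volume_sum_sq_lt t, hK, hK', pow_mul, pow_mul,
    Real.sq_sqrt ht, Real.sq_sqrt Real.pi_pos.le, ENNReal.toReal_mul, ENNReal.toReal_pow,
    ENNReal.toReal_ofReal (by positivity), ENNReal.toReal_prod,
    Finset.prod_congr rfl (g := fun n ↦ ((1 - ρ n ^ 2) ^ m)⁻¹), Finset.prod_inv_distrib]
  · rw [mul_pow, div_pow, ← pow_mul, ← pow_mul, div_eq_mul_inv, div_eq_mul_inv, mul_inv]
    ring
  · intro n hn
    have h := one_sub_sq_pos (hρ n (Finset.ne_of_mem_erase hn))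
    rw [ENNReal.toReal_ofReal (by positivity), pow_mul, Real.sq_sqrt h.le]

lemma volume_outageRegion_ne_top {N : ℕ} [NeZero N] [Nonempty K] (ρ : Fin N → ℝ)
    (hρ : ∀ n, n ≠ 0 → |ρ n| < 1) (t : ℝ) : volume (outageRegion K ρ t) ≠ ∞ := by
  rw [volume_outageRegion ρ hρ t, volume_sum_sq_lt t]
  exact ENNReal.mul_ne_top (by finiteness) (ENNReal.prod_ne_top fun _ _ ↦ ENNReal.ofReal_ne_top)

/-- This makes the region shrink to the origin at rate `√t`, which bounds the Gaussian density on it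
from below. -/
lemma exists_sq_le_of_mem_outageRegion {N : ℕ} [NeZero N] (ρ : Fin N → ℝ)
    (hρ : ∀ n, n ≠ 0 → |ρ n| < 1) :
    ∃ C : ℝ, ∀ t, ∀ z ∈ outageRegion K ρ t, ∀ n j, z n j ^ 2 ≤ C * t := by
  have hrow : ∀ n, ∃ C : ℝ, ∀ t, ∀ z ∈ outageRegion K ρ t, ∀ j, z n j ^ 2 ≤ C * t := by
    intro n
    have hcoord : ∀ t, ∀ z ∈ outageRegion K ρ t, ∀ n j, correlate ρ z n j ^ 2 ≤ t :=
      fun t z hz n j ↦ (Finset.single_le_sum (f := fun j ↦ correlate ρ z n j ^ 2)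
        (fun _ _ ↦ sq_nonneg _) (Finset.mem_univ j)).trans (hz n).le
    have hzero : ∀ t, ∀ z ∈ outageRegion K ρ t, ∀ j, z 0 j ^ 2 ≤ t := fun t z hz j ↦ by
      simpa [correlate] using hcoord t z hz 0 j
    by_cases hn : n = 0
    · exact ⟨1, fun t z hz j ↦ by rw [one_mul, hn]; exact hzero t z hz j⟩
    · have hc := one_sub_sq_pos (hρ n hn)
      refine ⟨4 / (1 - ρ n ^ 2), fun t z hz j ↦ ?_⟩
      have h1 := hcoord t z hz n j
      have h0 := hzero t z hz j
      simp only [correlate, hn, if_false] at h1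
      rw [div_mul_eq_mul_div, le_div_iff₀ hc]
      have hs := Real.sq_sqrt hc.le
      have h3 : ρ n ^ 2 * z 0 j ^ 2 ≤ 1 * t := by
        gcongr
        linarith
      calc z n j ^ 2 * (1 - ρ n ^ 2) = (√(1 - ρ n ^ 2) * z n j) ^ 2 := by rw [mul_pow, hs]; ring
        _ ≤ 2 * (√(1 - ρ n ^ 2) * z n j + ρ n * z 0 j) ^ 2 + 2 * (ρ n ^ 2 * z 0 j ^ 2) := by
          -- This is `p² ≤ 2 (p + q)² + 2 q²`, whose defect is `(p + 2q)²`; both squares on the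
          -- right are at most `t`, hence the `4`.
          nlinarith [sq_nonneg (√(1 - ρ n ^ 2) * z n j + 2 * (ρ n * z 0 j))]
        _ ≤ 4 * t := by linarith
  choose C hC using hrow
  refine ⟨∑ n, |C n|, fun t z hz n j ↦ (hC n t z hz j).trans ?_⟩
  have ht : 0 ≤ t := (Finset.sum_nonneg fun j _ ↦ sq_nonneg _).trans (hz 0).le
  gcongr
  exact (le_abs_self _).trans
    (Finset.single_le_sum (f := fun n ↦ |C n|) (fun _ _ ↦ abs_nonneg _) (Finset.mem_univ n))

/-- The Gaussian probability of the outage region is asymptotic to its volume times the density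
at the origin. -/
lemma tendsto_gaussianArray_outageRegion {N m : ℕ} [NeZero N] [NeZero m] (ρ : Fin N → ℝ)
    (hρ : ∀ n, n ≠ 0 → |ρ n| < 1) :
    Tendsto (fun t ↦ (gaussianArray (Fin N) (Fin m ⊕ Fin m)).real (outageRegion _ ρ t)
      / t ^ (m * N)) (𝓝[>] 0)
      (𝓝 (Real.Gamma ((m : ℝ) + 1) ^ N *
        ∏ n ∈ Finset.univ.erase (0 : Fin N), (1 - ρ n ^ 2) ^ m)⁻¹) := by
  obtain ⟨C, hC⟩ := exists_sq_le_of_mem_outageRegion (K := Fin m ⊕ Fin m) ρ hρ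
  have hK : Fintype.card (Fin m ⊕ Fin m) = 2 * m := by simp [two_mul]
  have hπ : ((√Real.pi)⁻¹ ^ (2 * m)) ^ N = (Real.pi ^ (m * N))⁻¹ := by
    rw [pow_mul, inv_pow, Real.sq_sqrt Real.pi_pos.le, inv_pow, inv_pow, pow_mul]
  have hπ0 : Real.pi ^ (m * N) ≠ 0 := by positivity
  set D := Real.Gamma ((m : ℝ) + 1) ^ N *
    ∏ n ∈ Finset.univ.erase (0 : Fin N), (1 - ρ n ^ 2) ^ m with hD
  -- Each of the `2mN` coordinates costs at most a factor `exp (-C t)` against the peak density. The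
  -- upper bound is `D⁻¹` itself.
  have hlow : Tendsto (fun t : ℝ ↦ (Real.exp (-(C * t)) ^ (2 * m)) ^ N * D⁻¹) (𝓝[>] 0)
      (𝓝 D⁻¹) := by
    have : Continuous fun t : ℝ ↦ (Real.exp (-(C * t)) ^ (2 * m)) ^ N * D⁻¹ := by fun_prop
    simpa using (this.tendsto 0).mono_left nhdsWithin_le_nhds
  refine tendsto_of_tendsto_of_tendsto_of_le_of_le' hlow tendsto_const_nhds ?_ ?_
  · filter_upwards [self_mem_nhdsWithin] with t ht
    have ht0 : 0 < t := ht
    rw [le_div_iff₀ (by positivity)]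
    refine le_trans (le_of_eq ?_) (le_gaussianArray_real (hC t))
    rw [volume_real_outageRegion ρ hρ ht0.le, Fintype.card_fin, hK, mul_pow, mul_pow, hπ, ← hD]
    field_simp
  · filter_upwards [self_mem_nhdsWithin] with t ht
    have ht0 : 0 < t := ht
    rw [div_le_iff₀ (by positivity)]
    have hne : Nonempty (Fin m ⊕ Fin m) := ⟨Sum.inl 0⟩
    refine (gaussianArray_real_le (volume_outageRegion_ne_top ρ hρ t)).trans (le_of_eq ?_)
    rw [volume_real_outageRegion ρ hρ ht0.le, Fintype.card_fin, hK, hπ, ← hD]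
    field_simp

end Volume

/-! ### The channel in terms of the Gaussian array -/

section Channel

variable {Ω : Type*} {N m : ℕ}

/-- Real and imaginary parts of the uncorrelated gains, as one array of reals. -/
def realArray (x y : Fin N → Fin m → Ω → ℝ) (ω : Ω) (n : Fin N) (j : Fin m ⊕ Fin m) : ℝ :=
  Sum.elim (fun k ↦ x n k ω) (fun k ↦ y n k ω) j

lemma channel_eq_sum_correlate [NeZero N] (ρ : Fin N → ℝ) (x y : Fin N → Fin m → Ω → ℝ)
    (n : Fin N) (ω : Ω) :
    channel ρ x y n ω = ∑ j, correlate ρ (realArray x y ω) n j ^ 2 := by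
  rw [channel, Fintype.sum_sum_type, ← Finset.sum_add_distrib]
  refine Finset.sum_congr rfl fun k _ ↦ ?_
  rw [gain, ← Complex.normSq_eq_norm_sq]
  by_cases hn : n = 0
  · simp [hn, correlate, realArray, Complex.normSq_apply, sq]
  · simp only [hn, correlate, realArray, if_false, Sum.elim_inl, Sum.elim_inr,
      mul_comm Complex.I, Complex.normSq_add_mul_I]

lemma channel_nonneg [NeZero N] (ρ : Fin N → ℝ) (x y : Fin N → Fin m → Ω → ℝ) (n : Fin N) (ω : Ω) :
    0 ≤ channel ρ x y n ω :=
  Finset.sum_nonneg fun _ _ ↦ sq_nonneg _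

lemma logb_selectedSNR_lt_iff [NeZero N] [NeZero m] (ρ : Fin N → ℝ) (x y : Fin N → Fin m → Ω → ℝ)
    (θ : ℝ) {s : ℝ} (hs : 0 < s) (ω : Ω) :
    Real.logb 2 (1 + selectedSNR ρ x y s ω) < θ ↔
      realArray x y ω ∈ outageRegion _ ρ ((m : ℝ) * ((2 : ℝ) ^ θ - 1) / s) := by
  have hm : (0 : ℝ) < m := by exact_mod_cast Nat.pos_of_ne_zero (NeZero.ne m)
  have h0 : 0 ≤ selectedSNR ρ x y s ω :=
    (mul_nonneg (div_nonneg hs.le hm.le) (channel_nonneg ρ x y 0 ω)).trans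
      (Finset.le_sup' (fun n ↦ portSNR ρ x y s n ω) (Finset.mem_univ 0))
  rw [Real.logb_lt_iff_lt_rpow one_lt_two (by linarith), ← lt_sub_iff_add_lt', selectedSNR,
    Finset.sup'_lt_iff]
  simp only [Finset.mem_univ, true_imp_iff, portSNR, channel_eq_sum_correlate]
  refine forall_congr' fun n ↦ ?_
  rw [lt_div_iff₀ hs, div_mul_eq_mul_div, div_lt_iff₀ hm, mul_comm s, mul_comm _ (m : ℝ)]

variable [MeasurableSpace Ω] {μ : Measure Ω}

lemma hasLaw_realArray {x y : Fin N → Fin m → Ω → ℝ}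
    (hx : ∀ n k, HasLaw (x n k) (gaussianReal 0 (1 / 2)) μ)
    (hy : ∀ n k, HasLaw (y n k) (gaussianReal 0 (1 / 2)) μ)
    (hindep : iIndepFun
      (Sum.elim (fun p : Fin N × Fin m ↦ x p.1 p.2) (fun p : Fin N × Fin m ↦ y p.1 p.2)) μ) :
    HasLaw (realArray x y) (gaussianArray (Fin N) (Fin m ⊕ Fin m)) μ := by
  have h := hindep.precomp (Equiv.prodSumDistrib (Fin N) (Fin m) (Fin m)).injective
  have hlaw : ∀ q, HasLaw (Sum.elim (fun p : Fin N × Fin m ↦ x p.1 p.2)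
      (fun p : Fin N × Fin m ↦ y p.1 p.2) (Equiv.prodSumDistrib (Fin N) (Fin m) (Fin m) q))
      (gaussianReal 0 (1 / 2)) μ := by
    rintro ⟨n, k | k⟩
    · exact hx n k
    · exact hy n k
  have hjoint := h.hasLaw_pi hlaw
  -- Independence gives a product law on the flat index set of pairs; currying turns it into the
  -- iterated product.
  have hcurry := Measure.infinitePi_map_curry
    (fun (_ : Fin N) (_ : Fin m ⊕ Fin m) ↦ gaussianReal 0 (1 / 2))
  simp only [Measure.infinitePi_eq_pi] at hcurry
  have hc : HasLaw (MeasurableEquiv.curry (Fin N) (Fin m ⊕ Fin m) ℝ)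
      (gaussianArray (Fin N) (Fin m ⊕ Fin m)) (Measure.pi fun _ ↦ gaussianReal 0 (1 / 2)) :=
    ⟨(MeasurableEquiv.measurable _).aemeasurable, hcurry⟩
  convert hc.comp hjoint using 1
  ext ω n j
  rcases j with k | k <;> rfl

lemma outageProbability_eq [NeZero N] [NeZero m] (ρ : Fin N → ℝ) {x y : Fin N → Fin m → Ω → ℝ}
    (hlaw : HasLaw (realArray x y) (gaussianArray (Fin N) (Fin m ⊕ Fin m)) μ)
    (θ : ℝ) {s : ℝ} (hs : 0 < s) :
    outageProbability μ ρ x y θ s = (gaussianArray (Fin N) (Fin m ⊕ Fin m)).real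
      (outageRegion _ ρ ((m : ℝ) * ((2 : ℝ) ^ θ - 1) / s)) := by
  simp only [outageProbability, logb_selectedSNR_lt_iff ρ x y θ hs]
  exact hlaw.measureReal_eq (measurableSet_outageRegion ρ _)

/-! ### The mean signal-to-noise ratio -/

lemma integral_sq_of_hasLaw {X : Ω → ℝ} (hX : HasLaw X (gaussianReal 0 (1 / 2)) μ) :
    ∫ ω, X ω ^ 2 ∂μ = 1 / 2 := by
  have h := hX.variance_eq
  have : IsProbabilityMeasure μ := hX.isProbabilityMeasure
  rw [variance_id_gaussianReal, variance_of_integral_eq_zero hX.aemeasurable] at h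
  · simpa using h
  · rw [hX.integral_eq, integral_id_gaussianReal]

lemma memLp_two_of_hasLaw {X : Ω → ℝ} (hX : HasLaw X (gaussianReal 0 (1 / 2)) μ) :
    MemLp X 2 μ := by
  have h := memLp_id_gaussianReal' (μ := 0) (v := 1 / 2) 2 (by simp)
  rw [← hX.map_eq] at h
  simpa using h.comp_of_map hX.aemeasurable

lemma memLp_two_correlate [NeZero N] (ρ : Fin N → ℝ) {x y : Fin N → Fin m → Ω → ℝ}
    (hZ : ∀ n j, HasLaw (fun ω ↦ realArray x y ω n j) (gaussianReal 0 (1 / 2)) μ)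
    (n : Fin N) (j : Fin m ⊕ Fin m) :
    MemLp (fun ω ↦ correlate ρ (realArray x y ω) n j) 2 μ := by
  by_cases hn : n = 0
  · simpa [hn, correlate] using memLp_two_of_hasLaw (hZ 0 j)
  · simp only [hn, correlate, if_false]
    exact ((memLp_two_of_hasLaw (hZ n j)).const_mul _).add
      ((memLp_two_of_hasLaw (hZ 0 j)).const_mul _)

/-- The squared weights `1 - ρₙ²` and `ρₙ²` sum to `1`, and the cross term vanishes by independence
and centring. -/
lemma integral_correlate_sq [NeZero N] {ρ : Fin N → ℝ} (hρ : ∀ n, n ≠ 0 → |ρ n| < 1)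
    {x y : Fin N → Fin m → Ω → ℝ}
    (hZ : ∀ n j, HasLaw (fun ω ↦ realArray x y ω n j) (gaussianReal 0 (1 / 2)) μ)
    (hindep : ∀ n, n ≠ 0 → ∀ j, IndepFun (fun ω ↦ realArray x y ω n j)
      (fun ω ↦ realArray x y ω 0 j) μ) (n : Fin N) (j : Fin m ⊕ Fin m) :
    ∫ ω, correlate ρ (realArray x y ω) n j ^ 2 ∂μ = 1 / 2 := by
  by_cases hn : n = 0
  · simpa [hn, correlate] using integral_sq_of_hasLaw (hZ 0 j)
  · set U := fun ω ↦ realArray x y ω n j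
    set V := fun ω ↦ realArray x y ω 0 j
    have hU := memLp_two_of_hasLaw (hZ n j)
    have hV := memLp_two_of_hasLaw (hZ 0 j)
    have hUV : ∫ ω, U ω * V ω ∂μ = 0 := by
      rw [(hindep n hn j).integral_fun_mul_eq_mul_integral hU.1 hV.1, (hZ n j).integral_eq,
        integral_id_gaussianReal, zero_mul]
    have hUV' : Integrable (fun ω ↦ U ω * V ω) μ := hU.integrable_mul hV
    have hexp : ∀ ω, correlate ρ (realArray x y ω) n j ^ 2
        = (1 - ρ n ^ 2) * U ω ^ 2 + ρ n ^ 2 * V ω ^ 2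
          + 2 * √(1 - ρ n ^ 2) * ρ n * (U ω * V ω) := by
      intro ω
      have hs := Real.sq_sqrt (one_sub_sq_pos (hρ n hn)).le
      simp only [correlate, hn, if_false]
      calc _ = √(1 - ρ n ^ 2) ^ 2 * U ω ^ 2 + ρ n ^ 2 * V ω ^ 2
          + 2 * √(1 - ρ n ^ 2) * ρ n * (U ω * V ω) := by ring
        _ = _ := by rw [hs]
    have hU2 : Integrable (fun ω ↦ (1 - ρ n ^ 2) * U ω ^ 2) μ := hU.integrable_sq.const_mul _
    have hV2 : Integrable (fun ω ↦ ρ n ^ 2 * V ω ^ 2) μ := hV.integrable_sq.const_mul _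
    have hUV2 : Integrable (fun ω ↦ (1 - ρ n ^ 2) * U ω ^ 2 + ρ n ^ 2 * V ω ^ 2) μ := hU2.add hV2
    simp_rw [hexp]
    rw [integral_add hUV2 (hUV'.const_mul _), integral_add hU2 hV2,
      integral_const_mul, integral_const_mul, integral_const_mul, hUV,
      integral_sq_of_hasLaw (hZ n j), integral_sq_of_hasLaw (hZ 0 j)]
    ring

lemma integral_portSNR [NeZero N] [NeZero m] {ρ : Fin N → ℝ} (hρ : ∀ n, n ≠ 0 → |ρ n| < 1)
    {x y : Fin N → Fin m → Ω → ℝ}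
    (hx : ∀ n k, HasLaw (x n k) (gaussianReal 0 (1 / 2)) μ)
    (hy : ∀ n k, HasLaw (y n k) (gaussianReal 0 (1 / 2)) μ)
    (hindep : iIndepFun
      (Sum.elim (fun p : Fin N × Fin m ↦ x p.1 p.2) (fun p : Fin N × Fin m ↦ y p.1 p.2)) μ)
    (s : ℝ) (n : Fin N) : ∫ ω, portSNR ρ x y s n ω ∂μ = s := by
  have hZ : ∀ n j, HasLaw (fun ω ↦ realArray x y ω n j) (gaussianReal 0 (1 / 2)) μ := by
    rintro n (k | k)
    · exact hx n k
    · exact hy n k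
  have hind : ∀ n, n ≠ 0 → ∀ j, IndepFun (fun ω ↦ realArray x y ω n j)
      (fun ω ↦ realArray x y ω 0 j) μ := by
    rintro n hn (k | k)
    · exact hindep.indepFun (i := Sum.inl (n, k)) (j := Sum.inl (0, k)) (by simpa using hn)
    · exact hindep.indepFun (i := Sum.inr (n, k)) (j := Sum.inr (0, k)) (by simpa using hn)
  have hm : (m : ℝ) ≠ 0 := by exact_mod_cast NeZero.ne m
  simp only [portSNR, channel_eq_sum_correlate]
  rw [integral_const_mul, integral_finsetSum _ fun j _ ↦
    (memLp_two_correlate ρ hZ n j).integrable_sq]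
  simp only [integral_correlate_sq hρ hZ hind, Finset.sum_const, Finset.card_univ,
    Fintype.card_sum, Fintype.card_fin, nsmul_eq_mul]
  push_cast
  field_simp
  ring

/-! ### Asymptotics of the outage probability -/

lemma outageGain_pos [NeZero N] [NeZero m] {ρ : Fin N → ℝ} (hρ : ∀ n, n ≠ 0 → |ρ n| < 1) {θ : ℝ}
    (hθ : 0 < θ) : 0 < outageGain m ρ θ := by
  have hm : (0 : ℝ) < m := by exact_mod_cast Nat.pos_of_ne_zero (NeZero.ne m)
  have h2 : 0 < (2 : ℝ) ^ θ - 1 := sub_pos.2 (Real.one_lt_rpow one_lt_two hθ)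
  have hΓ : 0 < Real.Gamma ((m : ℝ) + 1) := Real.Gamma_pos_of_pos (by positivity)
  have hprod : 0 < ∏ n ∈ Finset.univ.erase (0 : Fin N), (1 - ρ n ^ 2) ^ m :=
    Finset.prod_pos fun n hn ↦ pow_pos (one_sub_sq_pos (hρ n (Finset.ne_of_mem_erase hn))) m
  unfold outageGain
  positivity

lemma hasOutageGain_outageProbability [NeZero N] [NeZero m] {ρ : Fin N → ℝ}
    (hρ : ∀ n, n ≠ 0 → |ρ n| < 1) {x y : Fin N → Fin m → Ω → ℝ}
    (hlaw : HasLaw (realArray x y) (gaussianArray (Fin N) (Fin m ⊕ Fin m)) μ)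
    {θ : ℝ} (hθ : 0 < θ) :
    HasOutageGain (outageProbability μ ρ x y θ) (m * N) (outageGain m ρ θ) := by
  have hm : (0 : ℝ) < m := by exact_mod_cast Nat.pos_of_ne_zero (NeZero.ne m)
  have h2 : 0 < (2 : ℝ) ^ θ - 1 := sub_pos.2 (Real.one_lt_rpow one_lt_two hθ)
  set a := (m : ℝ) * ((2 : ℝ) ^ θ - 1) with ha
  have ha0 : 0 < a := by positivity
  have ht : Tendsto (fun s : ℝ ↦ a / s) atTop (𝓝[>] 0) :=
    tendsto_nhdsWithin_iff.2 ⟨tendsto_const_nhds.div_atTop tendsto_id,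
      (eventually_gt_atTop 0).mono fun s hs ↦ div_pos ha0 hs⟩
  have h := ((tendsto_gaussianArray_outageRegion (m := m) ρ hρ).comp ht).const_mul (a ^ (m * N))
  rw [← div_eq_mul_inv] at h
  refine h.congr' ?_
  filter_upwards [eventually_gt_atTop 0] with s hs
  rw [outageProbability_eq ρ hlaw θ hs, ← ha]
  simp only [Function.comp_apply, div_pow]
  field_simp

end Channel

/-- Since `log (P s * s ^ d)` converges, its quotient by `log s` vanishes in the limit; that
quotient is `d + log (P s) / log s`. -/
lemma HasOutageGain.hasDiversityOrder {P : ℝ → ℝ} {d : ℕ} {G : ℝ} (h : HasOutageGain P d G)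
    (hG : 0 < G) : HasDiversityOrder P d := by
  have hlog : Tendsto (fun s ↦ Real.log (P s * s ^ d)) atTop (𝓝 (Real.log G)) :=
    (Real.continuousAt_log hG.ne').tendsto.comp h
  have hquot := (hlog.div_atTop Real.tendsto_log_atTop).const_sub (d : ℝ)
  rw [sub_zero] at hquot
  refine hquot.congr' ?_
  filter_upwards [eventually_gt_atTop 1, h.eventually (lt_mem_nhds hG)] with s hs hP
  have hs0 : 0 < s := zero_lt_one.trans hs
  have hP0 : P s ≠ 0 := fun h0 ↦ by simp [h0] at hP
  have hl : Real.log s ≠ 0 := (Real.log_pos hs).ne'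
  rw [Real.log_mul hP0 (by positivity), Real.log_pow]
  field_simp
  ring

lemma HasOutageGain.isEquivalent {P : ℝ → ℝ} {d : ℕ} {G : ℝ} (h : HasOutageGain P d G)
    (hG : 0 < G) : P ~[atTop] fun s ↦ G / s ^ d := by
  rw [isEquivalent_iff_tendsto_one]
  · have h1 := Tendsto.div_const h G
    rw [div_self hG.ne'] at h1
    refine h1.congr' ?_
    filter_upwards [eventually_gt_atTop 0] with s hs
    simp only [Pi.div_apply]
    field_simp
  · filter_upwards [eventually_gt_atTop 0] with s hs
    positivity

end FluidAntenna

theorem corollary1 {Ω : Type*} [MeasurableSpace Ω] (μ : Measure Ω) [IsProbabilityMeasure μ]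
    {N m : ℕ} [NeZero N] (hm : 1 ≤ m)
    (x y : Fin N → Fin m → Ω → ℝ)
    (hx : ∀ n k, HasLaw (x n k) (gaussianReal 0 (1 / 2)) μ)
    (hy : ∀ n k, HasLaw (y n k) (gaussianReal 0 (1 / 2)) μ)
    (hindep : iIndepFun
      (Sum.elim (fun p : Fin N × Fin m => x p.1 p.2) (fun p : Fin N × Fin m => y p.1 p.2)) μ)
    (θ : ℝ) (hθ : 0 < θ) :
    -- arbitrary correlation coefficients
    (∀ ρ : Fin N → ℝ, (∀ n, n ≠ 0 → |ρ n| < 1) →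
      -- `s` is the average SNR at every port
      (∀ (s : ℝ) (n : Fin N), ∫ ω, portSNR ρ x y s n ω ∂μ = s) ∧
      (outageProbability μ ρ x y θ) ~[atTop]
        (fun s : ℝ => ((m : ℝ) / s * ((2 : ℝ) ^ θ - 1)) ^ (m * N)
          * (Real.Gamma ((m : ℝ) + 1) ^ (-(N : ℤ))
            / ∏ n ∈ Finset.univ.erase (0 : Fin N), (1 - ρ n ^ 2) ^ m)) ∧
      HasDiversityOrder (outageProbability μ ρ x y θ) ((m : ℝ) * (N : ℝ)) ∧
      0 < outageGain m ρ θ ∧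
      HasOutageGain (outageProbability μ ρ x y θ) (m * N) (outageGain m ρ θ)) ∧
    -- any topology, given by the displacements of the ports from the first one
    (∀ (lam : ℝ) (d : Fin N → ℝ), 0 < lam → (∀ n, n ≠ 0 → 0 < d n) →
      (∀ n, n ≠ 0 → |spatialCorrelation d lam n| < 1) ∧
      HasDiversityOrder (outageProbability μ (spatialCorrelation d lam) x y θ)
        ((m : ℝ) * (N : ℝ)) ∧
      HasOutageGain (outageProbability μ (spatialCorrelation d lam) x y θ) (m * N)
        (outageGain m (spatialCorrelation d lam) θ)) ∧
    -- the linear, circular and wheel-shaped topologies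
    (∀ (a : Architecture) (W lam : ℝ), 0 < W → 0 < lam →
      (∀ n : Fin N, n ≠ 0 → 0 < displacement a W lam n) ∧
      HasDiversityOrder
        (outageProbability μ (spatialCorrelation (displacement a W lam) lam) x y θ)
        ((m : ℝ) * (N : ℝ)) ∧
      HasOutageGain
        (outageProbability μ (spatialCorrelation (displacement a W lam) lam) x y θ) (m * N)
        (outageGain (N := N) m (spatialCorrelation (displacement a W lam) lam) θ)) := by
  have : NeZero m := ⟨by omega⟩
  have hlaw := hasLaw_realArray hx hy hindep
  have main : ∀ ρ : Fin N → ℝ, (∀ n, n ≠ 0 → |ρ n| < 1) →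
      HasDiversityOrder (outageProbability μ ρ x y θ) ((m : ℝ) * (N : ℝ)) ∧
      HasOutageGain (outageProbability μ ρ x y θ) (m * N) (outageGain m ρ θ) := by
    intro ρ hρ
    have h := hasOutageGain_outageProbability hρ hlaw hθ
    exact ⟨by exact_mod_cast h.hasDiversityOrder (outageGain_pos hρ hθ), h⟩
  refine ⟨fun ρ hρ ↦ ⟨integral_portSNR hρ hx hy hindep, ?_, (main ρ hρ).1, outageGain_pos hρ hθ,
    (main ρ hρ).2⟩, fun lam d hlam hd ↦ ?_, fun a W lam hW hlam ↦ ?_⟩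
  · convert (main ρ hρ).2.isEquivalent (outageGain_pos hρ hθ) using 2 with s
    rw [outageGain, zpow_neg, zpow_natCast, div_mul_eq_mul_div, div_pow]
    generalize Real.Gamma ((m : ℝ) + 1) ^ N = A
    generalize ∏ n ∈ Finset.univ.erase (0 : Fin N), (1 - ρ n ^ 2) ^ m = B
    rw [div_div, div_mul_div_comm, ← div_eq_mul_inv, div_div, mul_left_comm, mul_comm (s ^ _)]
  · have hρ : ∀ n, n ≠ 0 → |spatialCorrelation d lam n| < 1 := fun n hn ↦
      abs_spatialCorrelation_lt_one hlam (hd n hn)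
    exact ⟨hρ, main _ hρ⟩
  · have hd : ∀ n : Fin N, n ≠ 0 → 0 < displacement a W lam n := fun n hn ↦
      displacement_pos a hW hlam hn
    exact ⟨hd, main _ fun n hn ↦ abs_spatialCorrelation_lt_one hlam (hd n hn)⟩
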